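/- Conventions. An allowable sequence on a set of $m$ points is a doubly infinite sequence $\Pi=(\pi_i)_{i\in\mathbb Z}$ of permutations of the points for which there is an integer $h\ge 1$ such that: (a) $\pi_{i+h}$ is the reversal of $\pi_i$ for every $i$; (b) for every $i$, $\pi_i$ is obtained from $\pi_{i-1}$ by reversing one or more pairwise disjoint substrings of (at least two) consecutive elements; these reversals are called switches and together form the $i$-th move; (c) any two points take part in a common switch exactly once within each halfperiod $\pi_i,\pi_{i+1},\dots,\pi_{i+h}$. A switch is crossing if the substring it reverses is centered in the permutation. $\Pi$ is centrally symmetric if every point $p$ has a conjugate $\overline p$ such that the positions of $p$ and $\overline p$ in $\pi_i$ add up to $m+1$ for every $i$; it is in noncentral general position if every non-crossing switch reverses exactly two points; it is even-near-critical if $m$ is even and $h=m$. Its central signature is $(d_1,\dots,d_t)$ if exactly $t$ crossing switches occur in the halfperiod $\pi_0,\dots,\pi_h$ and the $k$-th of them reverses $2d_k$ points. For positive integers $d_1,\dots,d_t$ with $t\ge 2$ and $n=d_1+\dots+d_t$, $\mathrm{DC}^{cs}_{ncgen}(d_1,\dots,d_t)$ denotes the unique even-near-critical centrally symmetric allowable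 sequence in noncentral general position on $2n$ points with central signature $(d_1,\dots,d_t)$, $\pi_0=(1,2,\dots,n,\overline n,\dots,\overline 2,\overline 1)$, and a crossing switch in the first move. An allowable sequence is geometrically realizable if, for some labelling of some set of $m$ distinct points of the plane $\mathbb R^2$ by the points of the sequence, it is the circular sequence of that set, that is, the sequence of the orders of the orthogonal projections of the points onto a directed line that rotates. **Theorem 4.6.** Let $t\ge 3$ and let $d_1,\dots,d_t$ be positive integers such that $d_i\ge 3$ and $d_j\ge 2$ for some distinct indices $i,j\in\{1,\dots,t\}$. Then the allowable sequence $\mathrm{DC}^{cs}_{ncgen}(d_1,\dots,d_t)$ is not geometrically realizable. -/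

import Mathlib

/-- `IsMove σ τ S`: the permutation `τ` is obtained from `σ` by reversing one or more disjoint
substrings of consecutive elements.  A permutation of the points `Fin m` is given by its
position map (`σ a` is the position of the point `a`, positions counted from `0`), and each reversed
substring (a *switch*) is recorded in `S` as the pair `(first position, last position)`. -/
structure IsMove {m : ℕ} (σ τ : Equiv.Perm (Fin m)) (S : Set (Fin m × Fin m)) : Prop where
  nonempty : S.Nonempty
  lt : ∀ s ∈ S, s.1 < s.2
  disjoint : ∀ s ∈ S, ∀ s' ∈ S, s ≠ s' → s.2 < s'.1 ∨ s'.2 < s.1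
  reverse : ∀ s ∈ S, ∀ a, σ a ∈ Set.Icc s.1 s.2 →
    (τ a : ℕ) + (σ a : ℕ) = (s.1 : ℕ) + (s.2 : ℕ)
  fixed : ∀ a, (∀ s ∈ S, σ a ∉ Set.Icc s.1 s.2) → τ a = σ a

/-- An allowable sequence on the `m` points `Fin m`. -/
structure AllowableSequence (m : ℕ) where
  /-- `perm i a` is the position of the point `a` in the permutation `π_i`. -/
  perm : ℤ → Equiv.Perm (Fin m)
  /-- The switches of the `i`-th move, which leads from `π_{i-1}` to `π_i`
  (they are determined by `perm`). -/
  switches : ℤ → Set (Fin m × Fin m)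
  /-- The length of a halfperiod. -/
  h : ℕ
  h_pos : 0 < h
  /-- `π_{i+h}` is the reversal of `π_i`. -/
  perm_add_h : ∀ i a, perm (i + h) a = (perm i a).rev
  isMove : ∀ i, IsMove (perm (i - 1)) (perm i) (switches i)
  /-- Any two points take part in a common switch exactly once within a halfperiod. -/
  pair_once : ∀ i a b, a ≠ b → ∃! j : ℤ, (i < j ∧ j ≤ i + h) ∧
    ∃ s ∈ switches j, perm (j - 1) a ∈ Set.Icc s.1 s.2 ∧ perm (j - 1) b ∈ Set.Icc s.1 s.2

/-- A switch is crossing if the substring that it reverses is centered. -/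
def IsCrossing {m : ℕ} (s : Fin m × Fin m) : Prop := s.2 = s.1.rev

namespace AllowableSequence

/-- Every point has a conjugate, which occupies the mirror position in every permutation. -/
def CentrallySymmetric {m : ℕ} (A : AllowableSequence m) : Prop :=
  ∀ a, ∃ b, ∀ i, A.perm i b = (A.perm i a).rev

/-- All switches, except perhaps for the crossing ones, are transpositions. -/
def NoncentralGeneralPosition {m : ℕ} (A : AllowableSequence m) : Prop :=
  ∀ i, ∀ s ∈ A.switches i, ¬ IsCrossing s → (s.2 : ℕ) = (s.1 : ℕ) + 1

/-- An even number of points, and as many directions (moves in a halfperiod) as points. -/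
def EvenNearCritical {m : ℕ} (A : AllowableSequence m) : Prop :=
  Even m ∧ A.h = m

/-- `(d 0, …, d (t-1))` is the central signature: the halfperiod `π_0, …, π_h` contains exactly
`t` crossing switches, and the `k`-th of them in order of occurrence reverses `2 * d k` points. -/
def HasCentralSignature {m t : ℕ} (A : AllowableSequence m) (d : Fin t → ℕ) : Prop :=
  ∃ c : Fin t → ℤ, StrictMono c ∧
    (∀ i, i ∈ Set.range c ↔ (0 < i ∧ i ≤ A.h) ∧ ∃ s ∈ A.switches i, IsCrossing s) ∧
    ∀ k, ∃ s ∈ A.switches (c k), IsCrossing s ∧ (s.2 : ℕ) + 1 = (s.1 : ℕ) + 2 * d k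

/-- `A` is the sequence `DC^cs_ncgen(d)`: the even-near-critical centrally symmetric allowable
sequence in noncentral general position with central signature `d`, labelled so that `π_0` lists
the points in their natural order (the conjugate of `a` is then `a.rev`), and with a crossing
switch in the first move. -/
structure IsDCncgen {m t : ℕ} (A : AllowableSequence m) (d : Fin t → ℕ) : Prop where
  evenNearCritical : A.EvenNearCritical
  centrallySymmetric : A.CentrallySymmetric
  noncentral : A.NoncentralGeneralPosition
  signature : A.HasCentralSignature d
  perm_zero : A.perm 0 = 1
  first_move : ∃ s ∈ A.switches 1, IsCrossing s

end AllowableSequence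

/-- The coordinate of the orthogonal projection of `x` onto the line through the origin directed by
`(cos φ, sin φ)`. -/
noncomputable def projCoord (φ : ℝ) (x : EuclideanSpace ℝ (Fin 2)) : ℝ :=
  x 0 * Real.cos φ + x 1 * Real.sin φ

/-- `π` is a circular sequence of the labelled points `p`: `θ` enumerates in increasing order
the angles of a rotating directed line at which two of the points have the same projection, and
between two consecutive such angles the projections are in the order given by `π i`. -/
def IsCircularSequence {m : ℕ} (p : Fin m → EuclideanSpace ℝ (Fin 2))
    (π : ℤ → Equiv.Perm (Fin m)) : Prop :=
  ∃ θ : ℤ → ℝ, StrictMono θ ∧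
    Set.range θ = {φ | ∃ a b, a ≠ b ∧ projCoord φ (p a) = projCoord φ (p b)} ∧
    ∀ i, ∀ φ ∈ Set.Ioo (θ i) (θ (i + 1)), ∀ a b,
      π i a < π i b ↔ projCoord φ (p a) < projCoord φ (p b)

/-- `A` is the circular sequence of a set of points of the plane. -/
def AllowableSequence.GeometricallyRealizable {m : ℕ} (A : AllowableSequence m) : Prop :=
  ∃ p : Fin m → EuclideanSpace ℝ (Fin 2), Function.Injective p ∧ IsCircularSequence p A.perm

/-! Follow the points as wires. `W k p` is the `p`-th wire above the centre just after the `k`-th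
crossing, and `V l q` the `q`-th one just before the `l`-th. For `k < l < k + t`, each `W k p` is
transposed with each `V l q` strictly between the two crossings, earlier for larger `p` and later
for larger `q`. This forces `δ k + δ l ≤ T l - T k` (`δ_add_δ_le`). Each conjugate pair meets in a
crossing switch, so the numbers `2 * δ k` of one halfperiod sum to at least `m = h` (`card_le`).
Hence equality holds for consecutive crossings: the net is tight. Tightness then determines every
transposition time: twice the time is `T k + T l + δ k - δ l + 2 * (q - p)` (`Tight.hasTimes`).

In a realization, replace each point by its difference from its conjugate. The differences of the
wires of one crossing lie on a line through the origin, and a transposition makes two differences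
project equally. Let `a₁, a₂, a₃` come from crossing `k` and `b₁, b₂` from crossing `l`.
Transpositions with equal `q - p` are simultaneous, and these parallels give `a₂ = s a₁`, `b₂ = s
b₁`, `a₃ = s a₂`. The outermost wire entering crossing `k + 1` and the innermost one entering
crossing `k + 2` have differences `c` and `e` whose times match as well, so `e = s c`. Then `e` lies
on the line of crossing `k + 1`, which it must avoid (`false_of_parallels`). -/

/-- A family of wires `a : P` with integer heights `x i a` at the times `i : ℤ`, antisymmetric under
the conjugation `bar`, in which the heights strictly between `-2 * δ k` and `2 * δ k` are negated at
the crossing times `T k`, and all other changes of order are transpositions of adjacent heights. -/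
structure CrossingNet (P : Type*) where
  /-- the height of a wire at a time -/
  x : ℤ → P → ℤ
  /-- the conjugate wire -/
  bar : P → P
  /-- the halfperiod -/
  h : ℤ
  /-- the number of crossings in a halfperiod -/
  t : ℤ
  /-- the crossing times -/
  T : ℤ → ℤ
  /-- the half-widths of the crossings -/
  δ : ℤ → ℤ
  /-- the wire at height `2 * p - 1` immediately after the `k`-th crossing -/
  W : ℤ → ℤ → P
  x_bar : ∀ i a, x i (bar a) = -x i a
  x_inj : ∀ i a b, x i a = x i b → a = b
  x_add_h : ∀ i a, x (i + h) a = -x i a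
  between : ∀ i j k a b, i ≤ j → j ≤ k → k ≤ i + h → x i a < x i b → x k a < x k b → x j a < x j b
  swap : ∀ j a b, x (j - 1) a < x (j - 1) b → x j b < x j a →
    (0 < x (j - 1) a ∧ 0 < x j a) ∨ (0 < x (j - 1) b ∧ 0 < x j b) →
    x (j - 1) b = x (j - 1) a + 2 ∧ x j a = x (j - 1) b ∧ x j b = x (j - 1) a
  T_strictMono : StrictMono T
  T_add_t : ∀ k, T (k + t) = T k + h
  δ_pos : ∀ k, 0 < δ k
  cross : ∀ k a, -(2 * δ k) < x (T k - 1) a → x (T k - 1) a < 2 * δ k →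
    x (T k) a = -x (T k - 1) a
  not_cross : ∀ k a, 2 * δ k ≤ x (T k - 1) a → 2 * δ k ≤ x (T k) a
  x_W : ∀ k p, 1 ≤ p → p ≤ δ k → x (T k) (W k p) = 2 * p - 1

/-! ### Wires leaving and entering a crossing. -/

namespace CrossingNet

variable {P : Type*} (N : CrossingNet P)

/-- The wire at height `2 * q - 1` immediately before the `l`-th crossing. -/
def V (l q : ℤ) : P := N.bar (N.W l q)

/-- Heights outside the window of a crossing stay outside, below as well as above by conjugation, so
a wire found inside afterwards was negated. -/
theorem x_pred_W {k p : ℤ} (hp : 1 ≤ p) (hp' : p ≤ N.δ k) :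
    N.x (N.T k - 1) (N.W k p) = -(2 * p - 1) := by
  have h0 := N.x_W k p hp hp'
  by_cases h1 : 2 * N.δ k ≤ N.x (N.T k - 1) (N.W k p)
  · have := N.not_cross k _ h1
    omega
  by_cases h2 : N.x (N.T k - 1) (N.W k p) ≤ -(2 * N.δ k)
  · have h3 := N.not_cross k (N.bar (N.W k p)) (by rw [N.x_bar]; omega)
    rw [N.x_bar] at h3
    omega
  · have := N.cross k (N.W k p) (by omega) (by omega)
    omega

theorem x_pred_V {l q : ℤ} (hq : 1 ≤ q) (hq' : q ≤ N.δ l) :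
    N.x (N.T l - 1) (N.V l q) = 2 * q - 1 := by
  rw [V, N.x_bar, N.x_pred_W hq hq']
  ring

theorem x_V {l q : ℤ} (hq : 1 ≤ q) (hq' : q ≤ N.δ l) :
    N.x (N.T l) (N.V l q) = -(2 * q - 1) := by
  rw [V, N.x_bar, N.x_W l q hq hq']

theorem x_W_end {k p : ℤ} (hp : 1 ≤ p) (hp' : p ≤ N.δ k) :
    N.x (N.T k + N.h - 1) (N.W k p) = 2 * p - 1 := by
  rw [show N.T k + N.h - 1 = (N.T k - 1) + N.h by ring, N.x_add_h, N.x_pred_W hp hp']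
  ring

theorem x_V_start {l q : ℤ} (hq : 1 ≤ q) (hq' : q ≤ N.δ l) :
    N.x (N.T l - N.h) (N.V l q) = 2 * q - 1 := by
  have h1 := N.x_add_h (N.T l - N.h) (N.V l q)
  rw [sub_add_cancel, N.x_V hq hq'] at h1
  omega

theorem W_lt_W {k p p' i : ℤ} (hp : 1 ≤ p) (hpp : p < p') (hp' : p' ≤ N.δ k)
    (hi : N.T k ≤ i) (hi' : i < N.T k + N.h) : N.x i (N.W k p) < N.x i (N.W k p') := by
  refine N.between (N.T k) i (N.T k + N.h - 1) _ _ hi (by omega) (by omega) ?_ ?_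
  · rw [N.x_W k p hp (by omega), N.x_W k p' (by omega) hp']; omega
  · rw [N.x_W_end hp (by omega), N.x_W_end (by omega) hp']; omega

theorem V_lt_V {l q q' i : ℤ} (hq : 1 ≤ q) (hqq : q < q') (hq' : q' ≤ N.δ l)
    (hi : N.T l - N.h ≤ i) (hi' : i < N.T l) : N.x i (N.V l q) < N.x i (N.V l q') := by
  refine N.between (N.T l - N.h) i (N.T l - 1) _ _ hi (by omega) (by omega) ?_ ?_
  · rw [N.x_V_start hq (by omega), N.x_V_start (by omega) hq']; omega
  · rw [N.x_pred_V hq (by omega), N.x_pred_V (by omega) hq']; omega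

/-- The sign of a height is the order of the wire and its conjugate, to which `between` applies. -/
theorem W_pos {k p i : ℤ} (hp : 1 ≤ p) (hp' : p ≤ N.δ k) (hi : N.T k ≤ i)
    (hi' : i < N.T k + N.h) : 0 < N.x i (N.W k p) := by
  have := N.between (N.T k) i (N.T k + N.h - 1) (N.bar (N.W k p)) (N.W k p) hi (by omega)
    (by omega) (by rw [N.x_bar, N.x_W k p hp hp']; omega)
    (by rw [N.x_bar, N.x_W_end hp hp']; omega)
  rw [N.x_bar] at this
  omega

theorem V_pos {l q i : ℤ} (hq : 1 ≤ q) (hq' : q ≤ N.δ l) (hi : N.T l - N.h ≤ i)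
    (hi' : i < N.T l) : 0 < N.x i (N.V l q) := by
  have := N.between (N.T l - N.h) i (N.T l - 1) (N.bar (N.V l q)) (N.V l q) hi (by omega)
    (by omega) (by rw [N.x_bar, N.x_V_start hq hq']; omega)
    (by rw [N.x_bar, N.x_pred_V hq hq']; omega)
  rw [N.x_bar] at this
  omega

/-- A wire inside the window would change sign. -/
theorem far_of_pos {k : ℤ} {a : P} (h1 : 0 < N.x (N.T k - 1) a) (h2 : 0 < N.x (N.T k) a) :
    2 * N.δ k ≤ N.x (N.T k - 1) a ∧ 2 * N.δ k ≤ N.x (N.T k) a := by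
  have h0 := N.δ_pos k
  have h3 : 2 * N.δ k ≤ N.x (N.T k - 1) a := by
    by_contra h3
    have := N.cross k a (by omega) (by omega)
    omega
  exact ⟨h3, N.not_cross k a h3⟩

variable {N}

theorem T_lt_add {k l : ℤ} (hl : l < k + N.t) : N.T l < N.T k + N.h := by
  rw [← N.T_add_t]
  exact N.T_strictMono hl

theorem W_far {k l p : ℤ} (hkl : k < l) (hl : l < k + N.t) (hp : 1 ≤ p) (hp' : p ≤ N.δ k) :
    2 * N.δ l ≤ N.x (N.T l - 1) (N.W k p) ∧ 2 * N.δ l ≤ N.x (N.T l) (N.W k p) := by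
  have h1 := N.T_strictMono hkl
  have h2 := T_lt_add hl
  exact N.far_of_pos (N.W_pos hp hp' (by omega) (by omega)) (N.W_pos hp hp' (by omega) (by omega))

theorem V_far {k l q : ℤ} (hkl : k < l) (hl : l < k + N.t) (hq : 1 ≤ q) (hq' : q ≤ N.δ l) :
    2 * N.δ k ≤ N.x (N.T k - 1) (N.V l q) ∧ 2 * N.δ k ≤ N.x (N.T k) (N.V l q) := by
  have h1 := N.T_strictMono hkl
  have h2 := T_lt_add hl
  exact N.far_of_pos (N.V_pos hq hq' (by omega) (by omega)) (N.V_pos hq hq' (by omega) (by omega))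

theorem W_ne_V {k l p q : ℤ} (hkl : k < l) (hl : l < k + N.t) (hp : 1 ≤ p) (hp' : p ≤ N.δ k)
    (hq : 1 ≤ q) (hq' : q ≤ N.δ l) : N.W k p ≠ N.V l q := by
  intro he
  have h1 := (W_far hkl hl hp hp').2
  rw [he, N.x_V hq hq'] at h1
  have := N.δ_pos l
  omega

theorem V_ne_V {k l p q : ℤ} (hkl : k < l) (hl : l < k + N.t) (hp : 1 ≤ p) (hp' : p ≤ N.δ k)
    (hq : 1 ≤ q) (hq' : q ≤ N.δ l) : N.V k p ≠ N.V l q := by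
  intro he
  have h1 := (V_far hkl hl hq hq').2
  rw [← he, N.x_V hp hp'] at h1
  have := N.δ_pos k
  omega

theorem W_ne_W {k l p q : ℤ} (hkl : k < l) (hl : l < k + N.t) (hp : 1 ≤ p) (hp' : p ≤ N.δ k)
    (hq : 1 ≤ q) (hq' : q ≤ N.δ l) : N.W k p ≠ N.W l q := by
  intro he
  exact V_ne_V hkl hl hp hp' hq hq' (by rw [V, V, he])

/-- A wire that is transposed with another one keeps its order with respect to any third one. -/
theorem order_preserved {j : ℤ} {a b c : P} (hab : N.x (j - 1) a < N.x (j - 1) b)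
    (hba : N.x j b < N.x j a) (ha : 0 < N.x (j - 1) a) (ha' : 0 < N.x j a)
    (hb' : 0 < N.x j b) (hca : c ≠ a) (hcb : c ≠ b) :
    (N.x (j - 1) a < N.x (j - 1) c ↔ N.x j a < N.x j c) ∧
      (N.x (j - 1) b < N.x (j - 1) c ↔ N.x j b < N.x j c) := by
  obtain ⟨h1, h2, h3⟩ := N.swap j a b hab hba (.inl ⟨ha, ha'⟩)
  have hca0 : N.x (j - 1) c ≠ N.x (j - 1) a := fun h => hca (N.x_inj _ _ _ h)
  have hcb0 : N.x (j - 1) c ≠ N.x (j - 1) b := fun h => hcb (N.x_inj _ _ _ h)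
  have hca1 : N.x j c ≠ N.x j a := fun h => hca (N.x_inj _ _ _ h)
  have hcb1 : N.x j c ≠ N.x j b := fun h => hcb (N.x_inj _ _ _ h)
  -- Otherwise `swap` also applies to `c` and one of `a`, `b`, and the heights it prescribes clash
  -- with `h1`, `h2`, `h3` or make two wires coincide.
  refine ⟨⟨fun h => ?_, fun h => ?_⟩, ⟨fun h => ?_, fun h => ?_⟩⟩ <;> by_contra hc
  · have := N.swap j a c h (by omega) (.inl ⟨ha, ha'⟩)
    omega
  · have := N.swap j c a (by omega) h (.inr ⟨ha, ha'⟩)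
    omega
  · have := N.swap j b c h (by omega) (.inl ⟨by omega, hb'⟩)
    omega
  · have := N.swap j c b (by omega) h (.inr ⟨by omega, hb'⟩)
    omega

/-- `j` is a time of transposition of `W k p` and `V l q` strictly between the crossings `k`
and `l`. -/
def IsTime (k p l q j : ℤ) : Prop :=
  N.T k < j ∧ j < N.T l ∧
    ∀ i, N.T k ≤ i → i < N.T l → (N.x i (N.W k p) < N.x i (N.V l q) ↔ i < j)

/-- At `T k` the wire `V l q` is still outside the window that contains `W k p`; at `T l - 1` the
roles are exchanged. The first time in reversed order works, since `between` forbids a return. -/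
theorem exists_isTime {k l p q : ℤ} (hkl : k < l) (hl : l < k + N.t) (hp : 1 ≤ p) (hp' : p ≤ N.δ k)
    (hq : 1 ≤ q) (hq' : q ≤ N.δ l) : ∃ j, N.IsTime k p l q j := by
  have hT := N.T_strictMono hkl
  have hT' := T_lt_add hl
  have h0 : N.x (N.T k) (N.W k p) < N.x (N.T k) (N.V l q) := by
    have := (V_far hkl hl hq hq').2
    rw [N.x_W k p hp hp']
    omega
  have h1 : N.x (N.T l - 1) (N.V l q) < N.x (N.T l - 1) (N.W k p) := by
    have := (W_far hkl hl hp hp').1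
    rw [N.x_pred_V hq hq']
    omega
  have hne : ∀ i, N.x i (N.W k p) ≠ N.x i (N.V l q) := fun i h =>
    W_ne_V hkl hl hp hp' hq hq' (N.x_inj _ _ _ h)
  obtain ⟨j, ⟨hj, hj'⟩, hmin⟩ := Int.exists_least_of_bdd
    (P := fun i => N.T k ≤ i ∧ N.x i (N.V l q) < N.x i (N.W k p))
    ⟨N.T k, fun i hi => hi.1⟩ ⟨N.T l - 1, by omega, h1⟩
  have hjk : j ≠ N.T k := by rintro rfl; omega
  have hjl := hmin (N.T l - 1) ⟨by omega, h1⟩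
  refine ⟨j, by omega, by omega, fun i hi hi' => ⟨fun h => ?_, fun h => ?_⟩⟩
  · by_contra hc
    have := N.between j i (N.T l - 1) _ _ (by omega) (by omega) (by omega) hj' h1
    omega
  · by_contra hc
    have := hmin i ⟨hi, lt_of_le_of_ne (not_lt.1 hc) (hne i).symm⟩
    omega

theorem IsTime.lt {k p l q j i : ℤ} (h : N.IsTime k p l q j) (hi : N.T k ≤ i) (hij : i < j) :
    N.x i (N.W k p) < N.x i (N.V l q) :=
  (h.2.2 i hi (hij.trans h.2.1)).2 hij

theorem IsTime.gt {k p l q j i : ℤ} (hkl : k < l) (hl : l < k + N.t) (hp : 1 ≤ p) (hp' : p ≤ N.δ k)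
    (hq : 1 ≤ q) (hq' : q ≤ N.δ l) (h : N.IsTime k p l q j) (hij : j ≤ i) (hi : i < N.T l) :
    N.x i (N.V l q) < N.x i (N.W k p) := by
  have h1 : N.x i (N.W k p) ≠ N.x i (N.V l q) := fun h =>
    W_ne_V hkl hl hp hp' hq hq' (N.x_inj _ _ _ h)
  have h2 := h.2.2 i (by have := h.1; omega) hi
  omega

theorem IsTime.lt_of_lt {k p l q j i : ℤ} (h : N.IsTime k p l q j) (hi : i < N.T l)
    (hx : N.x i (N.W k p) < N.x i (N.V l q)) (hi' : N.T k ≤ i) : i < j :=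
  (h.2.2 i hi' hi).1 hx

theorem IsTime.le_of_gt {k p l q j i : ℤ} (h : N.IsTime k p l q j) (hi : N.T k ≤ i)
    (hx : N.x i (N.V l q) < N.x i (N.W k p)) : j ≤ i := by
  by_contra hc
  have := h.lt hi (not_le.1 hc)
  omega

theorem W_pos_of_le {k l p i : ℤ} (hl : l < k + N.t) (hp : 1 ≤ p) (hp' : p ≤ N.δ k)
    (hi : N.T k ≤ i) (hi' : i ≤ N.T l) :
    0 < N.x i (N.W k p) := by
  have := T_lt_add hl
  exact N.W_pos hp hp' hi (by omega)

theorem V_pos_of_lt {k l q i : ℤ} (hl : l < k + N.t) (hq : 1 ≤ q) (hq' : q ≤ N.δ l)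
    (hi : N.T k ≤ i) (hi' : i < N.T l) :
    0 < N.x i (N.V l q) := by
  have := T_lt_add hl
  exact N.V_pos hq hq' (by omega) hi'

theorem IsTime.swap {k l p q j : ℤ} (hkl : k < l) (hl : l < k + N.t)
    (hp : 1 ≤ p) (hp' : p ≤ N.δ k) (hq : 1 ≤ q) (hq' : q ≤ N.δ l)
    (h : N.IsTime k p l q j) :
    N.x (j - 1) (N.V l q) = N.x (j - 1) (N.W k p) + 2 ∧
      N.x j (N.W k p) = N.x (j - 1) (N.V l q) ∧ N.x j (N.V l q) = N.x (j - 1) (N.W k p) := by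
  have h1 := h.1
  have h2 := h.2.1
  exact N.swap j _ _ (h.lt (by omega) (by omega)) (h.gt hkl hl hp hp' hq hq' le_rfl h2)
    (.inl ⟨W_pos_of_le hl hp hp' (by omega) (by omega),
      W_pos_of_le hl hp hp' (by omega) (by omega)⟩)

theorem IsTime.preserved {k l p q j : ℤ} (hkl : k < l) (hl : l < k + N.t)
    (hp : 1 ≤ p) (hp' : p ≤ N.δ k) (hq : 1 ≤ q) (hq' : q ≤ N.δ l)
    (h : N.IsTime k p l q j) {c : P} (hc : c ≠ N.W k p) (hc' : c ≠ N.V l q) :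
    (N.x (j - 1) (N.W k p) < N.x (j - 1) c ↔ N.x j (N.W k p) < N.x j c) ∧
      (N.x (j - 1) (N.V l q) < N.x (j - 1) c ↔ N.x j (N.V l q) < N.x j c) := by
  have h1 := h.1
  have h2 := h.2.1
  exact order_preserved (h.lt (by omega) (by omega)) (h.gt hkl hl hp hp' hq hq' le_rfl h2)
    (W_pos_of_le hl hp hp' (by omega) (by omega)) (W_pos_of_le hl hp hp' (by omega) (by omega))
    (V_pos_of_lt hl hq hq' (by omega) (by omega)) hc hc'

/-- The wires `W k _` keep their order, so `W k p'` is above `V l q` once `W k p` has passed it; by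
`IsTime.preserved` it was there one step earlier already. -/
theorem isTime_lt_left {k l p p' q j j' : ℤ} (hkl : k < l) (hl : l < k + N.t)
    (hp : 1 ≤ p) (hpp : p < p') (hp' : p' ≤ N.δ k)
    (hq : 1 ≤ q) (hq' : q ≤ N.δ l) (h : N.IsTime k p l q j) (h' : N.IsTime k p' l q j') :
    j' < j := by
  have h1 := h.1
  have h2 := h.2.1
  have h3 := h.swap hkl hl hp (by omega) hq hq'
  have hT := T_lt_add hl
  have h4 := N.W_lt_W (i := j - 1) hp hpp hp' (by omega) (by omega)
  have h5 := N.W_lt_W (i := j) hp hpp hp' (by omega) (by omega)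
  have h6 : N.x (j - 1) (N.W k p') ≠ N.x (j - 1) (N.V l q) := fun h =>
    W_ne_V hkl hl (by omega) hp' hq hq' (N.x_inj _ _ _ h)
  by_contra hc
  have h7 := h'.lt (i := j - 1) (by omega) (by omega)
  have h8 := (h.preserved hkl hl hp (by omega) hq hq' (c := N.W k p')
    (fun e => by rw [e] at h4; omega) (fun e => h6 (by rw [e]))).2
  omega

theorem isTime_lt_right {k l p q q' j j' : ℤ} (hkl : k < l) (hl : l < k + N.t)
    (hp : 1 ≤ p) (hp' : p ≤ N.δ k) (hq : 1 ≤ q)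
    (hqq : q < q') (hq' : q' ≤ N.δ l) (h : N.IsTime k p l q j) (h' : N.IsTime k p l q' j') :
    j < j' := by
  have h1 := h'.1
  have h2 := h'.2.1
  have h3 := h'.swap hkl hl hp hp' (by omega) hq'
  have hT := T_lt_add hl
  have h4 := N.V_lt_V (i := j' - 1) hq hqq hq' (by omega) (by omega)
  have h6 : N.x (j' - 1) (N.W k p) ≠ N.x (j' - 1) (N.V l q) := fun h =>
    W_ne_V hkl hl hp hp' hq (by omega) (N.x_inj _ _ _ h)
  by_contra hc
  have h7 := h.lt (i := j' - 1) (by omega) (by omega)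
  have h5 := N.V_lt_V (i := j') hq hqq hq' (by omega) (by omega)
  have h8 := (h'.preserved hkl hl hp hp' (by omega) hq' (c := N.V l q)
    (fun e => h6 (by rw [e])) (fun e => by rw [e] at h4; omega)).1
  omega

end CrossingNet

/-! ### Transposition times and tight nets. -/

namespace CrossingNet

variable {P : Type*} {N : CrossingNet P}

variable (N) in
/-- The time of transposition of `W k p` and `V l q` between the crossings `k` and `l`. -/
noncomputable def τ (k p l q : ℤ) : ℤ := Classical.epsilon (N.IsTime k p l q)

theorem isTime_τ {k l p q : ℤ} (hkl : k < l) (hl : l < k + N.t) (hp : 1 ≤ p) (hp' : p ≤ N.δ k)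
    (hq : 1 ≤ q) (hq' : q ≤ N.δ l) : N.IsTime k p l q (N.τ k p l q) :=
  Classical.epsilon_spec (exists_isTime hkl hl hp hp' hq hq')

theorem τ_left {k l p p' q : ℤ} (hkl : k < l) (hl : l < k + N.t) (hp : 1 ≤ p) (hpp : p ≤ p')
    (hp' : p' ≤ N.δ k) (hq : 1 ≤ q) (hq' : q ≤ N.δ l) :
    N.τ k p' l q + p' ≤ N.τ k p l q + p := by
  induction p', hpp using Int.leInduction with
  | base => rfl
  | succ r hr ih =>
    have h1 := ih (by omega)
    have h2 := isTime_lt_left hkl hl (p := r) (p' := r + 1) (by omega) (by omega) hp' hq hq'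
      (isTime_τ hkl hl (by omega) (by omega) hq hq') (isTime_τ hkl hl (by omega) hp' hq hq')
    omega

theorem τ_right {k l p q q' : ℤ} (hkl : k < l) (hl : l < k + N.t) (hp : 1 ≤ p) (hp' : p ≤ N.δ k)
    (hq : 1 ≤ q) (hqq : q ≤ q') (hq' : q' ≤ N.δ l) :
    N.τ k p l q - q ≤ N.τ k p l q' - q' := by
  induction q', hqq using Int.leInduction with
  | base => rfl
  | succ r hr ih =>
    have h1 := ih (by omega)
    have h2 := isTime_lt_right hkl hl (q := r) (q' := r + 1) hp hp' (by omega) (by omega) hq'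
      (isTime_τ hkl hl hp hp' (by omega) (by omega)) (isTime_τ hkl hl hp hp' (by omega) hq')
    omega

/-- Lowering `p` from `δ k` to `1` at `q = 1` and then raising `q` to `δ l` gives a chain of `δ k +
δ l - 1` increasing times strictly between `T k` and `T l`. -/
theorem δ_add_δ_le {k l : ℤ} (hkl : k < l) (hl : l < k + N.t) :
    N.δ k + N.δ l ≤ N.T l - N.T k := by
  have hk := N.δ_pos k
  have hl' := N.δ_pos l
  have h1 := (isTime_τ hkl hl (p := N.δ k) (q := 1) hk le_rfl le_rfl hl').1
  have h2 := (isTime_τ hkl hl (p := 1) (q := N.δ l) le_rfl hk hl' le_rfl).2.1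
  have h3 := τ_left hkl hl (p := 1) (p' := N.δ k) (q := 1) le_rfl hk le_rfl le_rfl hl'
  have h4 := τ_right hkl hl (p := 1) (q := 1) (q' := N.δ l) le_rfl hk le_rfl hl' le_rfl
  omega

variable (N) in
/-- Consecutive crossings are as close to each other as possible. -/
def Tight : Prop := ∀ k, N.T (k + 1) = N.T k + N.δ k + N.δ (k + 1)

theorem Tight.lower_strictMono (hN : N.Tight) : StrictMono fun k => N.T k - N.δ k :=
  strictMono_int_of_lt_succ fun k => by
    have := hN k
    have := N.δ_pos k
    omega

theorem Tight.parity (hN : N.Tight) {k l : ℤ} (h : k ≤ l) :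
    2 ∣ (N.T k + N.δ k) - (N.T l + N.δ l) := by
  induction l, h using Int.leInduction with
  | base => simp
  | succ r hr ih =>
    have := hN r
    omega

/-- The intervals `[T k - δ k, T k + δ k)` tile the integers. -/
theorem Tight.exists_block (hN : N.Tight) {k l y : ℤ} (hk : N.T k - N.δ k ≤ y)
    (hl : y < N.T l - N.δ l) : ∃ m, k ≤ m ∧ m < l ∧ N.T m - N.δ m ≤ y ∧ y < N.T m + N.δ m := by
  obtain ⟨m, hm, hmax⟩ := Int.exists_greatest_of_bdd (P := fun m => N.T m - N.δ m ≤ y)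
    ⟨l, fun z hz => by
      by_contra hc
      have := hN.lower_strictMono (not_le.1 hc)
      dsimp only at this
      omega⟩ ⟨k, hk⟩
  refine ⟨m, hmax k hk, ?_, hm, ?_⟩
  · by_contra hc
    have := hN.lower_strictMono.monotone (not_lt.1 hc)
    omega
  · by_contra hc
    have := hmax (m + 1) (by have := hN m; omega)
    omega

/-- The formula for the times of transposition. -/
def HasTimes (N : CrossingNet P) (k l : ℤ) : Prop :=
  ∀ p q, 1 ≤ p → p ≤ N.δ k → 1 ≤ q → q ≤ N.δ l →
    2 * N.τ k p l q = N.T k + N.T l + N.δ k - N.δ l + 2 * (q - p)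

/-- By monotonicity, `τ + p - q` is smallest at the corner `(δ k, 1)` and largest at `(1, δ l)`; the
two bounds squeeze it to a constant. -/
theorem hasTimes_of_bounds {k l : ℤ} (hkl : k < l) (hl : l < k + N.t)
    (h1 : N.T k + N.T l + N.δ k - N.δ l ≤ 2 * (N.τ k (N.δ k) l 1 + N.δ k - 1))
    (h2 : 2 * (N.τ k 1 l (N.δ l) + 1 - N.δ l) ≤ N.T k + N.T l + N.δ k - N.δ l) :
    N.HasTimes k l := by
  intro p q hp hp' hq hq'
  have hk := N.δ_pos k
  have hl' := N.δ_pos l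
  have h3 := τ_left hkl hl hp hp' le_rfl hq hq'
  have h4 := τ_left hkl hl le_rfl hp hp' hq hq'
  have h5 := τ_right hkl hl hk le_rfl le_rfl hq hq'
  have h6 := τ_right hkl hl le_rfl hk hq hq' le_rfl
  omega

/-- Here the chain of times behind `δ_add_δ_le` has no slack. -/
theorem Tight.hasTimes_succ (hN : N.Tight) (ht : 1 < N.t) (k : ℤ) : N.HasTimes k (k + 1) := by
  have hkl : k < k + 1 := by omega
  have hl : k + 1 < k + N.t := by omega
  have hk := N.δ_pos k
  have hl' := N.δ_pos (k + 1)
  have h1 := (isTime_τ hkl hl (p := N.δ k) (q := 1) hk le_rfl le_rfl hl').1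
  have h2 := (isTime_τ hkl hl (p := 1) (q := N.δ (k + 1)) le_rfl hk hl' le_rfl).2.1
  have h3 := hN k
  exact hasTimes_of_bounds hkl hl (by omega) (by omega)

/-- Just before `T l`, `V (l + 1) 1` is above `V l (δ l)`. Going back to time `s`, the latter is
transposed at every step with some `W m p`, so it has no chance to change order with `V (l + 1) 1`.
Thus `W k (δ k)` passes `V l (δ l)` before it passes `V (l + 1) 1`. -/
theorem Tight.lower (hN : N.Tight) {k l : ℤ} (hkl : k < l) (hl : l + 1 < k + N.t)
    (ih : ∀ m, k ≤ m → m < l → N.HasTimes m l) :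
    N.τ k (N.δ k) l (N.δ l) < N.τ k (N.δ k) (l + 1) 1 := by
  have hk := N.δ_pos k
  have hl' := N.δ_pos l
  have hl1 := N.δ_pos (l + 1)
  have hT := N.T_strictMono hkl
  have hT1 := N.T_strictMono (lt_add_one l)
  have hs := isTime_τ hkl (by omega) (p := N.δ k) (q := N.δ l) hk le_rfl hl' le_rfl
  have hs2 := ih k le_rfl hkl _ _ hk le_rfl hl' le_rfl
  set s := N.τ k (N.δ k) l (N.δ l)
  have hs0 := hs.1
  have hs1 := hs.2.1
  have hneW : ∀ m p, k ≤ m → m < l → 1 ≤ p → p ≤ N.δ m → N.V (l + 1) 1 ≠ N.W m p :=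
    fun m p hm hm' hp hp' =>
      (W_ne_V (by omega) (by omega) hp hp' le_rfl hl1).symm
  have hneV : N.V (l + 1) 1 ≠ N.V l (N.δ l) :=
    (V_ne_V (lt_add_one l) (by omega) hl' le_rfl le_rfl hl1).symm
  have key : ∀ i, s ≤ i → i ≤ N.T l - 1 → N.x i (N.V l (N.δ l)) < N.x i (N.V (l + 1) 1) := by
    intro i hi hi'
    induction i, hi' using Int.leInductionDown with
    | base =>
      have h1 := (V_far (lt_add_one l) (by omega : l + 1 < l + N.t) le_rfl hl1).1
      rw [N.x_pred_V hl' le_rfl]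
      omega
    | pred j hj ih' =>
      have h1 := ih' (by omega)
      -- By the formula, `V l (δ l)` meets `W m p` at time `j` exactly when `2 * j - T l - δ l = T m
      -- + δ m - 2 * p`. The tiling supplies `m`, and parity supplies `p`.
      obtain ⟨m, hm, hm', hm1, hm2⟩ := hN.exists_block (k := k) (l := l)
        (y := 2 * j - N.T l - N.δ l) (by omega) (by omega)
      have hpar := hN.parity hm'.le
      obtain ⟨p, hp⟩ : ∃ p, N.T m + N.δ m - (2 * j - N.T l - N.δ l) = 2 * p :=
        ⟨_, (Int.mul_ediv_cancel' (by omega)).symm⟩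
      have h2 := ih m hm hm' p (N.δ l) (by omega) (by omega) hl' le_rfl
      have h3 : N.τ m p l (N.δ l) = j := by omega
      have h4 := isTime_τ (N := N) hm' (by omega) (p := p) (q := N.δ l) (by omega) (by omega) hl'
        le_rfl
      rw [h3] at h4
      exact (h4.preserved hm' (by omega) (by omega) (by omega) hl' le_rfl
        (hneW m p hm hm' (by omega) (by omega)) hneV).2.2 h1
  have h1 := key s le_rfl (by omega)
  have h2 := hs.swap hkl (by omega) hk le_rfl hl' le_rfl
  have h3 := hs.preserved hkl (by omega) hk le_rfl hl' le_rfl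
    (hneW k _ le_rfl hkl hk le_rfl) hneV
  have h4 : N.x s (N.V (l + 1) 1) ≠ N.x s (N.W k (N.δ k)) := fun h =>
    hneW k _ le_rfl hkl hk le_rfl (N.x_inj _ _ _ h)
  refine (isTime_τ (by omega) (by omega) hk le_rfl le_rfl hl1).lt_of_lt (by omega) ?_ (by omega)
  have h5 : N.x (s - 1) (N.V (l + 1) 1) ≠ N.x (s - 1) (N.V l (N.δ l)) := fun h =>
    hneV (N.x_inj _ _ _ h)
  omega

/-- The time-reversed argument: from `T (k + 1)` to `s` the wire `W (k + 1) (δ (k + 1))` is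
transposed at every step with some `V m q`, so `W k 1` stays above it and passes `V l (δ l)` first.
-/
theorem Tight.upper (hN : N.Tight) {k l : ℤ} (hkl : k + 1 < l) (hl : l < k + N.t)
    (ih : ∀ m, k + 1 < m → m ≤ l → N.HasTimes (k + 1) m) :
    N.τ k 1 l (N.δ l) < N.τ (k + 1) (N.δ (k + 1)) l (N.δ l) := by
  have hk := N.δ_pos k
  have hk1 := N.δ_pos (k + 1)
  have hl' := N.δ_pos l
  have hT := N.T_strictMono hkl
  have hT1 := N.T_strictMono (lt_add_one k)
  have hs := isTime_τ hkl (by omega) (p := N.δ (k + 1)) (q := N.δ l) hk1 le_rfl hl' le_rfl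
  have hs2 := ih l hkl le_rfl _ _ hk1 le_rfl hl' le_rfl
  set s := N.τ (k + 1) (N.δ (k + 1)) l (N.δ l)
  have hs0 := hs.1
  have hs1 := hs.2.1
  have hneV : ∀ m q, k + 1 < m → m ≤ l → 1 ≤ q → q ≤ N.δ m → N.W k 1 ≠ N.V m q :=
    fun m q hm hm' hq hq' => W_ne_V (by omega) (by omega) le_rfl hk hq hq'
  have hneW : N.W k 1 ≠ N.W (k + 1) (N.δ (k + 1)) :=
    W_ne_W (lt_add_one k) (by omega) le_rfl hk hk1 le_rfl
  have key : ∀ i, N.T (k + 1) ≤ i → i < s →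
      N.x i (N.W (k + 1) (N.δ (k + 1))) < N.x i (N.W k 1) := by
    intro i hi hi'
    induction i, hi using Int.leInduction with
    | base =>
      have h1 := (W_far (lt_add_one k) (by omega) le_rfl hk).2
      rw [N.x_W _ _ hk1 le_rfl]
      omega
    | succ j hj ih' =>
      have h1 := ih' (by omega)
      obtain ⟨m, hm, hm', hm1, hm2⟩ := hN.exists_block (k := k + 2) (l := l + 1)
        (y := 2 * j - N.T (k + 1) + N.δ (k + 1))
        (by have := hN (k + 1); rw [show k + 1 + 1 = k + 2 by ring] at this; omega)
        (by have := hN l; omega)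
      have hpar := hN.parity (show k + 1 ≤ m by omega)
      obtain ⟨q, hq⟩ : ∃ q, 2 * j - N.T (k + 1) + N.δ (k + 1) - (N.T m - N.δ m) + 2
          = 2 * q := ⟨_, (Int.mul_ediv_cancel' (by omega)).symm⟩
      have h2 := ih m (by omega) (by omega) (N.δ (k + 1)) q hk1 le_rfl (by omega) (by omega)
      have h3 : N.τ (k + 1) (N.δ (k + 1)) m q = j + 1 := by omega
      have h4 := isTime_τ (N := N) (k := k + 1) (l := m) (by omega) (by omega) hk1 le_rfl
        (q := q) (by omega) (by omega)
      rw [h3] at h4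
      have h5 := (h4.preserved (by omega) (by omega) hk1 le_rfl (by omega) (by omega) hneW
        (hneV m q (by omega) (by omega) (by omega) (by omega))).1
      rw [add_sub_cancel_right] at h5
      exact h5.1 h1
  have h1 := key (s - 1) (by omega) (by omega)
  have h2 := hs.swap hkl (by omega) hk1 le_rfl hl' le_rfl
  have h3 := hs.preserved hkl (by omega) hk1 le_rfl hl' le_rfl hneW (hneV l _ hkl le_rfl hl' le_rfl)
  have h4 : N.x (s - 1) (N.W k 1) ≠ N.x (s - 1) (N.V l (N.δ l)) := fun h =>
    hneV l _ hkl le_rfl hl' le_rfl (N.x_inj _ _ _ h)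
  have h5 : N.x s (N.W k 1) ≠ N.x s (N.W (k + 1) (N.δ (k + 1))) := fun h =>
    hneW (N.x_inj _ _ _ h)
  have h6 := (isTime_τ (N := N) (k := k) (by omega) hl le_rfl hk hl' le_rfl).le_of_gt
    (i := s - 1) (by omega) (by omega)
  omega

/-- Induction on `l - k`: `Tight.lower` bounds the earliest time through the pair `(k, l - 1)`, and
`Tight.upper` the latest through `(k + 1, l)`. -/
theorem Tight.hasTimes (hN : N.Tight) (ht : 1 < N.t) {k l : ℤ} (hkl : k < l)
    (hl : l < k + N.t) : N.HasTimes k l := by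
  obtain ⟨r, rfl⟩ : ∃ r : ℕ, l = k + r := ⟨(l - k).toNat, by omega⟩
  induction r using Nat.strong_induction_on generalizing k with
  | _ r ih =>
    have ih' : ∀ m m' : ℤ, m < m' → m' - m < r → N.HasTimes m m' := by
      intro m m' h h'
      have := ih (m' - m).toNat (by omega) (k := m) (by omega) (by omega)
      rwa [show m + ((m' - m).toNat : ℤ) = m' by omega] at this
    rcases (show r = 1 ∨ 1 < r by omega) with rfl | hr
    · exact hN.hasTimes_succ ht k
    have hk := N.δ_pos k
    have hk1 := N.δ_pos (k + 1)
    have hl' := N.δ_pos (k + r)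
    have hl1 := N.δ_pos (k + r - 1)
    have h1 := hN.lower (k := k) (l := k + r - 1) (by omega) (by omega)
      fun m hm hm' => ih' _ _ (by omega) (by omega)
    have h2 := hN.upper (k := k) (l := k + r) (by omega) (by omega)
      fun m hm hm' => ih' _ _ (by omega) (by omega)
    have h3 := ih' k (k + r - 1) (by omega) (by omega) _ _ hk le_rfl hl1 le_rfl
    have h4 := ih' (k + 1) (k + r) (by omega) (by omega) _ _ hk1 le_rfl hl' le_rfl
    have h5 := hN k
    have h6 := hN (k + r - 1)
    rw [sub_add_cancel] at h1 h6
    exact hasTimes_of_bounds hkl hl (by omega) (by omega)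

/-- The time at which `W k p` and `V l q` are transposed, in a tight net. -/
theorem Tight.exists_isTime (hN : N.Tight) (ht : 1 < N.t) {k l p q : ℤ} (hkl : k < l)
    (hl : l < k + N.t) (hp : 1 ≤ p) (hp' : p ≤ N.δ k) (hq : 1 ≤ q) (hq' : q ≤ N.δ l) :
    ∃ j, 2 * j = N.T k + N.T l + N.δ k - N.δ l + 2 * (q - p) ∧ N.IsTime k p l q j :=
  ⟨_, hN.hasTimes ht hkl hl p q hp hp' hq hq', isTime_τ hkl hl hp hp' hq hq'⟩

end CrossingNet

/-! ### From moves to heights in an allowable sequence. -/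

namespace IsMove

variable {m : ℕ} {σ τ : Equiv.Perm (Fin m)} {S : Set (Fin m × Fin m)}

theorem mem_Icc (h : IsMove σ τ S) {s : Fin m × Fin m} (hs : s ∈ S) {a : Fin m}
    (ha : σ a ∈ Set.Icc s.1 s.2) : τ a ∈ Set.Icc s.1 s.2 := by
  have h1 := h.reverse s hs a ha
  rw [Set.mem_Icc, Fin.le_def, Fin.le_def] at ha ⊢
  omega

/-- A move preserves the order of a point and a position outside the point's switch. -/
theorem lt_iff_of_notMem (h : IsMove σ τ S) {s : Fin m × Fin m} (hs : s ∈ S) {b x : Fin m}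
    (hx : x ∈ Set.Icc s.1 s.2) (hb : σ b ∉ Set.Icc s.1 s.2) :
    (x < σ b ↔ s.2 < τ b) ∧ (σ b < x ↔ τ b < s.1) := by
  have hlt := h.lt s hs
  by_cases hb' : ∃ s' ∈ S, σ b ∈ Set.Icc s'.1 s'.2
  · obtain ⟨s', hs', hbs⟩ := hb'
    have hd := h.disjoint s hs s' hs' (by rintro rfl; exact hb hbs)
    have h2 := h.mem_Icc hs' hbs
    simp only [Set.mem_Icc, Fin.le_def, Fin.lt_def] at *
    omega
  · push Not at hb'
    rw [h.fixed b hb']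
    simp only [Set.mem_Icc, Fin.le_def, Fin.lt_def] at *
    omega

theorem lt_of_not_joint (h : IsMove σ τ S) {a b : Fin m}
    (hn : ¬∃ s ∈ S, σ a ∈ Set.Icc s.1 s.2 ∧ σ b ∈ Set.Icc s.1 s.2) (hab : σ a < σ b) :
    τ a < τ b := by
  push Not at hn
  by_cases ha : ∃ s ∈ S, σ a ∈ Set.Icc s.1 s.2
  · obtain ⟨s, hs, has⟩ := ha
    have h1 := ((h.lt_iff_of_notMem hs has (hn s hs has)).1).1 hab
    exact (h.mem_Icc hs has).2.trans_lt h1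
  · push Not at ha
    rw [h.fixed a ha]
    by_cases hb : ∃ s ∈ S, σ b ∈ Set.Icc s.1 s.2
    · obtain ⟨s, hs, hbs⟩ := hb
      have h1 := ((h.lt_iff_of_notMem hs hbs (ha s hs)).2).1 hab
      rw [h.fixed a ha] at h1
      exact h1.trans_le (h.mem_Icc hs hbs).1
    · push Not at hb
      rwa [h.fixed b hb]

end IsMove

namespace AllowableSequence

variable {m : ℕ} (A : AllowableSequence m)

/-- The points `a` and `b` take part in a common switch of the `j`-th move. -/
def Joint (j : ℤ) (a b : Fin m) : Prop :=
  ∃ s ∈ A.switches j, A.perm (j - 1) a ∈ Set.Icc s.1 s.2 ∧ A.perm (j - 1) b ∈ Set.Icc s.1 s.2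

/-- Twice the distance of the position of a point from the centre of the permutation. -/
def height (i : ℤ) (a : Fin m) : ℤ := 2 * (A.perm i a : ℤ) - (m - 1)

variable {A}

theorem height_lt_height {i : ℤ} {a b : Fin m} :
    A.height i a < A.height i b ↔ A.perm i a < A.perm i b := by
  rw [height, height, Fin.lt_def]
  omega

theorem height_injective (i : ℤ) : Function.Injective (A.height i) := by
  intro a b h
  refine (A.perm i).injective (Fin.ext ?_)
  rw [height, height] at h
  omega

theorem height_add_h (i : ℤ) (a : Fin m) : A.height (i + A.h) a = -A.height i a := by
  rw [height, height, A.perm_add_h, Fin.val_rev]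
  have := (A.perm i a).isLt
  omega

theorem height_lt_of_not_joint {j : ℤ} {a b : Fin m} (h : ¬A.Joint j a b)
    (hab : A.height (j - 1) a < A.height (j - 1) b) : A.height j a < A.height j b := by
  rw [height_lt_height] at *
  exact (A.isMove j).lt_of_not_joint h hab

theorem joint_of_height_lt {j : ℤ} {a b : Fin m} (hab : A.height (j - 1) a < A.height (j - 1) b)
    (hba : A.height j b < A.height j a) : A.Joint j a b := by
  by_contra h
  have := height_lt_of_not_joint h hab
  omega

theorem exists_joint {i j : ℤ} (hij : i ≤ j) {a b : Fin m} (hab : A.height i a < A.height i b)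
    (hba : A.height j b < A.height j a) : ∃ l, i < l ∧ l ≤ j ∧ A.Joint l a b := by
  induction j, hij using Int.leInduction with
  | base => omega
  | succ r hr ih =>
    rcases lt_trichotomy (A.height r a) (A.height r b) with h | h | h
    · exact ⟨r + 1, by omega, le_rfl, joint_of_height_lt (by rwa [add_sub_cancel_right]) hba⟩
    · rw [height_injective r h] at hab
      omega
    · obtain ⟨l, hl, hl', hj⟩ := ih h
      exact ⟨l, hl, by omega, hj⟩

theorem Joint.symm {j : ℤ} {a b : Fin m} (h : A.Joint j a b) : A.Joint j b a := by
  obtain ⟨s, hs, ha, hb⟩ := h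
  exact ⟨s, hs, hb, ha⟩

/-- A change of order and a change back would be two common switches within one halfperiod. -/
theorem height_lt_between {i j k : ℤ} {a b : Fin m} (hij : i ≤ j) (hjk : j ≤ k) (hk : k ≤ i + A.h)
    (h1 : A.height i a < A.height i b) (h2 : A.height k a < A.height k b) :
    A.height j a < A.height j b := by
  have hab : a ≠ b := by rintro rfl; omega
  rcases lt_trichotomy (A.height j a) (A.height j b) with h | h | h
  · exact h
  · exact absurd (height_injective j h) hab
  · obtain ⟨l, hl, hl', hj⟩ := exists_joint hij h1 h
    obtain ⟨l', hm, hm', hj'⟩ := exists_joint hjk h h2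
    have := (A.pair_once i a b hab).unique ⟨⟨hl, by omega⟩, hj⟩ ⟨⟨by omega, by omega⟩, hj'.symm⟩
    omega

theorem crossing_data {s : Fin m × Fin m} {δ : ℕ} (hs : IsCrossing s)
    (hδ : (s.2 : ℕ) + 1 = s.1 + 2 * δ) : m = 2 * s.1 + 2 * δ := by
  rw [IsCrossing] at hs
  rw [hs, Fin.val_rev] at hδ
  have := s.1.isLt
  omega

theorem height_of_crossing {j : ℤ} {s : Fin m × Fin m} (h : s ∈ A.switches j) (hs : IsCrossing s)
    {a : Fin m} (ha : A.perm (j - 1) a ∈ Set.Icc s.1 s.2) : A.height j a = -A.height (j - 1) a := by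
  have h1 := (A.isMove j).reverse s h a ha
  rw [IsCrossing] at hs
  rw [hs, Fin.val_rev] at h1
  have := s.1.isLt
  rw [height, height]
  omega

theorem exists_height_eq {p : ℤ} (hm : Even m) (hp : 0 < 2 * p + m) (hp' : 2 * p ≤ m) (i : ℤ) :
    ∃ a, A.height i a = 2 * p - 1 := by
  obtain ⟨n, rfl⟩ := hm
  refine ⟨(A.perm i).symm ⟨(n + p - 1).toNat, by omega⟩, ?_⟩
  rw [height, Equiv.apply_symm_apply]
  dsimp only
  omega

/-- Carries the crossings of one halfperiod to all others. -/
theorem height_add_mul_h (z : ℤ) :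
    (∀ i a, A.height (i + A.h * z) a = A.height i a) ∨
      ∀ i a, A.height (i + A.h * z) a = -A.height i a := by
  induction z using Int.induction_on with
  | zero => simp
  | succ n ih =>
    rcases ih with ih | ih
    · refine .inr fun i a => ?_
      rw [mul_add, mul_one, ← add_assoc, height_add_h, ih]
    · refine .inl fun i a => ?_
      rw [mul_add, mul_one, ← add_assoc, height_add_h, ih, neg_neg]
  | pred n ih =>
    rcases ih with ih | ih
    · refine .inr fun i a => ?_
      rw [← ih i, ← neg_eq_iff_eq_neg, ← height_add_h]
      congr 1
      ring
    · refine .inl fun i a => ?_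
      rw [← neg_neg (A.height i a), ← ih i, ← neg_eq_iff_eq_neg, ← height_add_h]
      congr 1
      ring

theorem height_not_cross {j : ℤ} {s : Fin m × Fin m} {δ : ℕ} (h : s ∈ A.switches j)
    (hs : IsCrossing s) (hδ : (s.2 : ℕ) + 1 = s.1 + 2 * δ) {a : Fin m}
    (ha : 2 * (δ : ℤ) ≤ A.height (j - 1) a) : 2 * (δ : ℤ) ≤ A.height j a := by
  have hm := crossing_data hs hδ
  have hlt := (A.isMove j).lt s h
  rw [height] at *
  have h1 := (((A.isMove j).lt_iff_of_notMem h (b := a) (x := s.2) ⟨hlt.le, le_rfl⟩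
    (by rw [Set.mem_Icc, Fin.le_def, Fin.le_def]; omega)).1).1 (by rw [Fin.lt_def]; omega)
  rw [Fin.lt_def] at h1
  omega

theorem height_cross {j : ℤ} {s : Fin m × Fin m} {δ : ℕ} (h : s ∈ A.switches j)
    (hs : IsCrossing s) (hδ : (s.2 : ℕ) + 1 = s.1 + 2 * δ) {a : Fin m}
    (ha : -(2 * (δ : ℤ)) < A.height (j - 1) a) (ha' : A.height (j - 1) a < 2 * δ) :
    A.height j a = -A.height (j - 1) a := by
  have hm := crossing_data hs hδ
  refine height_of_crossing h hs ?_
  rw [height] at *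
  rw [Set.mem_Icc, Fin.le_def, Fin.le_def]
  omega

section IsDCncgen

variable {t : ℕ} {d : Fin t → ℕ}

theorem IsDCncgen.perm_rev (hA : A.IsDCncgen d) (i : ℤ) (a : Fin m) :
    A.perm i a.rev = (A.perm i a).rev := by
  obtain ⟨b, hb⟩ := hA.centrallySymmetric a
  have h0 := hb 0
  rw [hA.perm_zero, Equiv.Perm.one_apply, Equiv.Perm.one_apply] at h0
  rw [← h0, hb]

theorem IsDCncgen.height_rev (hA : A.IsDCncgen d) (i : ℤ) (a : Fin m) :
    A.height i a.rev = -A.height i a := by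
  rw [height, height, hA.perm_rev, Fin.val_rev]
  have := (A.perm i a).isLt
  omega

theorem IsDCncgen.even (hA : A.IsDCncgen d) : Even m := hA.evenNearCritical.1

theorem IsDCncgen.h_eq (hA : A.IsDCncgen d) : A.h = m := hA.evenNearCritical.2

theorem IsDCncgen.height_ne_zero (hA : A.IsDCncgen d) (i : ℤ) (a : Fin m) : A.height i a ≠ 0 := by
  obtain ⟨n, hn⟩ := hA.even
  rw [height]
  omega

/-- A crossing switch negates heights, so a wire that stays positive takes part in a non-crossing
one, which is a transposition. -/
theorem IsDCncgen.swap (hA : A.IsDCncgen d) {j : ℤ} {a b : Fin m}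
    (hab : A.height (j - 1) a < A.height (j - 1) b)
    (hba : A.height j b < A.height j a)
    (hp : (0 < A.height (j - 1) a ∧ 0 < A.height j a) ∨
      (0 < A.height (j - 1) b ∧ 0 < A.height j b)) :
    A.height (j - 1) b = A.height (j - 1) a + 2 ∧ A.height j a = A.height (j - 1) b ∧
      A.height j b = A.height (j - 1) a := by
  obtain ⟨s, hs, ha, hb⟩ := joint_of_height_lt hab hba
  by_cases hc : IsCrossing s
  · have h1 := height_of_crossing hs hc ha
    have h2 := height_of_crossing hs hc hb
    omega
  · have h1 := hA.noncentral j s hs hc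
    have h2 := (A.isMove j).reverse s hs a ha
    have h3 := (A.isMove j).reverse s hs b hb
    rw [Set.mem_Icc, Fin.le_def, Fin.le_def] at ha hb
    simp only [height] at *
    omega

theorem IsDCncgen.crossing_of_joint_rev (hA : A.IsDCncgen d) {j : ℤ} {a : Fin m}
    {s : Fin m × Fin m} (hs : s ∈ A.switches j) (ha : A.perm (j - 1) a ∈ Set.Icc s.1 s.2)
    (ha' : A.perm (j - 1) a.rev ∈ Set.Icc s.1 s.2) : IsCrossing s := by
  have h1 := (A.isMove j).reverse s hs a ha
  have h2 := (A.isMove j).reverse s hs _ ha'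
  rw [hA.perm_rev, hA.perm_rev, Fin.val_rev, Fin.val_rev] at h2
  have h3 := (A.perm j a).isLt
  have h4 := (A.perm (j - 1) a).isLt
  rw [IsCrossing, Fin.ext_iff, Fin.val_rev]
  omega

/-- Each point shares a switch with its conjugate; that switch is centered, so the substrings of the
crossing switches cover all points. -/
theorem IsDCncgen.card_le (hA : A.IsDCncgen d) : m ≤ ∑ k, 2 * d k := by
  classical
  obtain ⟨c, -, hc, hd⟩ := hA.signature
  choose s hs hsc hsd using hd
  have hcov : (Finset.univ : Finset (Fin m)) ⊆ Finset.univ.biUnion fun k =>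
      (Finset.Icc (s k).1 (s k).2).map (A.perm (c k - 1)).symm.toEmbedding := by
    intro a _
    have hne : a ≠ a.rev := by
      intro h
      have h1 := hA.height_rev 0 a
      have h2 := hA.height_ne_zero 0 a
      rw [← h] at h1
      omega
    obtain ⟨j, ⟨hj, s', hs', ha, ha'⟩, -⟩ := A.pair_once 0 a a.rev hne
    have hcr := hA.crossing_of_joint_rev hs' ha ha'
    obtain ⟨k, rfl⟩ := (hc j).2 ⟨by omega, s', hs', hcr⟩
    -- Two centered substrings overlap, so a move has at most one crossing switch.
    have heq : s' = s k := by
      by_contra hne'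
      have h1 := (A.isMove (c k)).disjoint s' hs' (s k) (hs k) hne'
      have h2 := (A.isMove (c k)).lt s' hs'
      have h3 := (A.isMove (c k)).lt (s k) (hs k)
      have h4 := hsc k
      rw [IsCrossing, Fin.ext_iff, Fin.val_rev] at h4 hcr
      simp only [Fin.lt_def] at h1 h2 h3
      omega
    simp only [Finset.mem_biUnion, Finset.mem_univ, true_and, Finset.mem_map_equiv,
      Equiv.symm_symm]
    exact ⟨k, by rw [Finset.mem_Icc, ← heq]; exact ha⟩
  have h1 := (Finset.card_le_card hcov).trans Finset.card_biUnion_le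
  rw [Finset.card_univ, Fintype.card_fin] at h1
  refine h1.trans (Finset.sum_le_sum fun k _ => ?_)
  rw [Finset.card_map, Fin.card_Icc, hsd k]
  omega

end IsDCncgen

end AllowableSequence

/-! ### Periodic extension of the crossing data. -/

/-- The residue of an integer as an element of `Fin t`. -/
def residue (t : ℕ) [NeZero t] (k : ℤ) : Fin t :=
  ⟨(k % t).toNat, by
    have := Int.emod_lt_of_pos k (show (0 : ℤ) < t by exact_mod_cast Nat.pos_of_neZero t)
    have := Int.emod_nonneg k (show (t : ℤ) ≠ 0 by exact_mod_cast NeZero.ne t)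
    omega⟩

section residue

variable {t : ℕ} [NeZero t]

theorem exists_eq_add_mul (k : ℤ) : ∃ (r : Fin t) (z : ℤ), k = r + t * z := by
  refine ⟨residue t k, k / t, ?_⟩
  have := Int.emod_nonneg k (show (t : ℤ) ≠ 0 by exact_mod_cast NeZero.ne t)
  rw [residue, Int.toNat_of_nonneg this, Int.emod_add_mul_ediv]

theorem add_mul_ediv_of_fin (r : Fin t) (z : ℤ) : ((r : ℤ) + t * z) / t = z := by
  rw [Int.add_mul_ediv_left _ _ (show (t : ℤ) ≠ 0 by exact_mod_cast NeZero.ne t),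
    Int.ediv_eq_zero_of_lt (by omega) (by omega), zero_add]

theorem residue_add_mul (r : Fin t) (z : ℤ) : residue t (r + t * z) = r := by
  refine Fin.ext ?_
  change (((r : ℤ) + t * z) % t).toNat = r
  rw [Int.add_mul_emod_self_left, Int.emod_eq_of_lt (by omega) (by omega), Int.toNat_natCast]

/-- A strictly increasing finite sequence spanning less than `h`, extended to `ℤ` by translations
by `h`. -/
def periodicExtension (c : Fin t → ℤ) (h : ℤ) (k : ℤ) : ℤ := c (residue t k) + h * (k / t)

theorem periodicExtension_add_mul (c : Fin t → ℤ) (h : ℤ) (r : Fin t) (z : ℤ) :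
    periodicExtension c h (r + t * z) = c r + h * z := by
  rw [periodicExtension, residue_add_mul, add_mul_ediv_of_fin]

theorem periodicExtension_add_period (c : Fin t → ℤ) (h : ℤ) (k : ℤ) :
    periodicExtension c h (k + t) = periodicExtension c h k + h := by
  obtain ⟨r, z, rfl⟩ := exists_eq_add_mul (t := t) k
  rw [show (r : ℤ) + t * z + t = r + t * (z + 1) by ring, periodicExtension_add_mul,
    periodicExtension_add_mul]
  ring

theorem periodicExtension_strictMono {c : Fin t → ℤ} {h : ℤ} (hc : StrictMono c)
    (hc0 : ∀ k, 0 < c k) (hch : ∀ k, c k ≤ h) : StrictMono (periodicExtension c h) := by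
  refine strictMono_int_of_lt_succ fun k => ?_
  obtain ⟨r, z, rfl⟩ := exists_eq_add_mul (t := t) k
  by_cases hr : (r : ℕ) + 1 < t
  · have h1 : (r : ℤ) + t * z + 1 = ((⟨r + 1, hr⟩ : Fin t) : ℕ) + t * z := by
      push_cast
      ring
    rw [h1, periodicExtension_add_mul, periodicExtension_add_mul]
    have := hc (show r < ⟨r + 1, hr⟩ from Fin.lt_def.2 (Nat.lt_succ_self _))
    omega
  -- Wrapping around: the last crossing time is at most `h`, and the next is `c 0 + h > h`, up to a
  -- common translation.
  · have h0 : (r : ℤ) + 1 = t := by omega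
    have h1 : (r : ℤ) + t * z + 1 = ((0 : Fin t) : ℕ) + t * (z + 1) := by
      rw [Fin.val_zero, mul_add, ← h0]
      push_cast
      ring
    rw [h1, periodicExtension_add_mul, periodicExtension_add_mul]
    have h2 := hc0 0
    have h3 := hch r
    rw [mul_add]
    omega

end residue

/-! ### Tightness, and the net of the given sequence. -/

namespace CrossingNet

variable {P : Type*} {N : CrossingNet P}

/-- If the half-widths are `t`-periodic and their total over a period is at least half of the
halfperiod, then the net is tight. -/
theorem tight_of_le_sum {t : ℕ} [NeZero t] (hNt : N.t = t) (ht : 1 < t) (d : Fin t → ℤ)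
    (hd : ∀ k, N.δ k = d (residue t k)) (hsum : N.h ≤ ∑ k, 2 * d k) : N.Tight := by
  have hle : ∀ k, N.δ k + N.δ (k + 1) ≤ N.T (k + 1) - N.T k := fun k =>
    δ_add_δ_le (lt_add_one k) (by omega)
  have hper : ∀ k, N.δ (k + t) = N.δ k := by
    intro k
    obtain ⟨r, z, rfl⟩ := exists_eq_add_mul (t := t) k
    rw [hd, hd, show (r : ℤ) + t * z + t = r + t * (z + 1) by ring, residue_add_mul,
      residue_add_mul]
  have hsumδ : ∑ i ∈ Finset.range t, N.δ i = ∑ k, d k := by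
    rw [Finset.sum_range]
    refine Finset.sum_congr rfl fun r _ => ?_
    have := residue_add_mul r 0
    rw [mul_zero, add_zero] at this
    rw [hd, this]
  have hsumδ' : ∑ i ∈ Finset.range t, N.δ ((i : ℤ) + 1) = ∑ k, d k := by
    rw [← hsumδ]
    have h1 := Finset.sum_range_succ (fun i : ℕ => N.δ i) t
    rw [Finset.sum_range_succ'] at h1
    have h2 := hper 0
    push_cast at h1
    rw [zero_add] at h2
    omega
  have hsumT : ∑ i ∈ Finset.range t, (N.T ((i : ℤ) + 1) - N.T i) = N.h := by
    have h1 := Finset.sum_range_sub (fun i : ℕ => N.T i) t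
    have h2 := N.T_add_t 0
    rw [hNt, zero_add] at h2
    push_cast at h1
    rw [h1, h2]
    ring
  -- Over one period the left sides total `2 * ∑ d k ≥ h` and the gaps total `h`, so each termwise
  -- inequality is an equality.
  have heq : ∀ i ∈ Finset.range t, N.δ (i : ℤ) + N.δ ((i : ℤ) + 1) = N.T ((i : ℤ) + 1) - N.T i := by
    refine (Finset.sum_eq_sum_iff_of_le fun (i : ℕ) _ => hle (i : ℤ)).1 ?_
    refine le_antisymm (Finset.sum_le_sum fun i _ => hle i) ?_
    rw [hsumT, Finset.sum_add_distrib, hsumδ, hsumδ']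
    rw [← Finset.mul_sum] at hsum
    omega
  intro k
  obtain ⟨r, z, rfl⟩ := exists_eq_add_mul (t := t) k
  induction z using Int.induction_on with
  | zero =>
    have := heq r (Finset.mem_range.2 r.isLt)
    rw [mul_zero, add_zero]
    omega
  | succ n ih =>
    rw [mul_add, mul_one, ← add_assoc, hper, add_right_comm, hper, ← hNt, N.T_add_t, N.T_add_t]
    rw [← hNt] at ih
    omega
  | pred n ih =>
    have h1 := N.T_add_t ((r : ℤ) + t * (-n - 1))
    have h2 := N.T_add_t ((r : ℤ) + t * (-n - 1) + 1)
    have h3 := hper ((r : ℤ) + t * (-n - 1))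
    have h4 := hper ((r : ℤ) + t * (-n - 1) + 1)
    rw [hNt, show (r : ℤ) + t * (-n - 1) + t = r + t * -n by ring] at h1
    rw [hNt, show (r : ℤ) + t * (-n - 1) + 1 + t = r + t * -n + 1 by ring] at h2
    rw [show (r : ℤ) + t * (-n - 1) + t = r + t * -n by ring] at h3
    rw [show (r : ℤ) + t * (-n - 1) + 1 + t = r + t * -n + 1 by ring] at h4
    omega

end CrossingNet

namespace AllowableSequence

variable {m : ℕ} {A : AllowableSequence m}

theorem IsDCncgen.exists_net {t : ℕ} [NeZero t] {d : Fin t → ℕ} (hA : A.IsDCncgen d) (ht : 1 < t)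
    (hd : ∀ k, 0 < d k) :
    ∃ N : CrossingNet (Fin m), N.x = A.height ∧ N.bar = Fin.rev ∧ N.h = A.h ∧ N.t = t ∧
      (∀ k, N.δ k = d (residue t k)) ∧ N.Tight := by
  obtain ⟨c, hcm, hc, hcd⟩ := hA.signature
  choose s hs hsc hsd using hcd
  have hc0 : ∀ k, 0 < c k ∧ c k ≤ A.h := fun k => ((hc (c k)).1 ⟨k, rfl⟩).1
  have hcross : ∀ k a, -(2 * (d (residue t k) : ℤ)) < A.height (periodicExtension c A.h k - 1) a →
      A.height (periodicExtension c A.h k - 1) a < 2 * d (residue t k) →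
      A.height (periodicExtension c A.h k) a = -A.height (periodicExtension c A.h k - 1) a := by
    intro k a
    obtain ⟨r, z, rfl⟩ := exists_eq_add_mul (t := t) k
    rw [periodicExtension_add_mul, residue_add_mul,
      show c r + A.h * z - 1 = c r - 1 + A.h * z by ring]
    have key := height_cross (hs r) (hsc r) (hsd r) (a := a)
    rcases height_add_mul_h (A := A) z with h | h
    · rw [h, h]
      exact key
    · rw [h, h]
      omega
  have hncross : ∀ k a, 2 * (d (residue t k) : ℤ) ≤ A.height (periodicExtension c A.h k - 1) a →
      2 * (d (residue t k) : ℤ) ≤ A.height (periodicExtension c A.h k) a := by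
    intro k a
    obtain ⟨r, z, rfl⟩ := exists_eq_add_mul (t := t) k
    rw [periodicExtension_add_mul, residue_add_mul,
      show c r + A.h * z - 1 = c r - 1 + A.h * z by ring]
    rcases height_add_mul_h (A := A) z with h | h
    · rw [h, h]
      exact height_not_cross (hs r) (hsc r) (hsd r)
    -- After an odd number of halfperiods all heights are negated; pass to the conjugate.
    · rw [h, h, ← hA.height_rev, ← hA.height_rev]
      exact height_not_cross (hs r) (hsc r) (hsd r)
  have hW : ∀ k p : ℤ, ∃ a, 1 ≤ p → p ≤ d (residue t k) →
      A.height (periodicExtension c A.h k) a = 2 * p - 1 := by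
    intro k p
    have hm := crossing_data (hsc (residue t k)) (hsd (residue t k))
    by_cases hp : 1 ≤ p ∧ p ≤ d (residue t k)
    · obtain ⟨a, ha⟩ := exists_height_eq (A := A) (p := p) hA.even (by omega) (by omega)
        (periodicExtension c A.h k)
      exact ⟨a, fun _ _ => ha⟩
    -- Out of range any point will do; this one shows that `Fin m` is inhabited.
    · exact ⟨(s (residue t k)).1, fun h h' => absurd ⟨h, h'⟩ hp⟩
  choose W hW using hW
  let N : CrossingNet (Fin m) :=
    { x := A.height
      bar := Fin.rev
      h := A.h
      t := t
      T := periodicExtension c A.h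
      δ := fun k => d (residue t k)
      W := W
      x_bar := hA.height_rev
      x_inj := fun i _ _ h => height_injective i h
      x_add_h := height_add_h
      between := fun _ _ _ _ _ hij hjk hk => height_lt_between hij hjk hk
      swap := fun _ _ _ => hA.swap
      T_strictMono := periodicExtension_strictMono hcm (fun k => (hc0 k).1) fun k => (hc0 k).2
      T_add_t := periodicExtension_add_period c A.h
      δ_pos := fun k => by exact_mod_cast hd _
      cross := hcross
      not_cross := hncross
      x_W := hW }
  refine ⟨N, rfl, rfl, rfl, rfl, fun k => rfl, ?_⟩
  refine CrossingNet.tight_of_le_sum (N := N) rfl ht (fun k => d k) (fun k => rfl) ?_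
  change (A.h : ℤ) ≤ _
  rw [hA.h_eq]
  exact_mod_cast hA.card_le

end AllowableSequence

/-! ### Plane geometry of projections. -/

section projCoord

local notation "E" => EuclideanSpace ℝ (Fin 2)

theorem projCoord_sub (φ : ℝ) (x y : E) : projCoord φ (x - y) = projCoord φ x - projCoord φ y := by
  simp only [projCoord, PiLp.sub_apply]
  ring

theorem projCoord_smul (φ r : ℝ) (x : E) : projCoord φ (r • x) = r * projCoord φ x := by
  simp only [projCoord, PiLp.smul_apply, smul_eq_mul]
  ring

/-- A vector projecting to zero in the direction `φ` is a multiple of the unit normal. -/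
theorem exists_of_projCoord_eq_zero {φ : ℝ} {x : E} (h : projCoord φ x = 0) :
    ∃ r, x 0 = -(r * Real.sin φ) ∧ x 1 = r * Real.cos φ := by
  rw [projCoord] at h
  have h1 := Real.sin_sq_add_cos_sq φ
  refine ⟨x 1 * Real.cos φ - x 0 * Real.sin φ, ?_, ?_⟩
  · linear_combination Real.cos φ * h - x 0 * h1
  · linear_combination Real.sin φ * h - x 1 * h1

theorem eq_smul_of_projCoord_eq_zero {φ : ℝ} {x y : E} (hx : x ≠ 0) (h : projCoord φ x = 0)
    (h' : projCoord φ y = 0) : ∃ r : ℝ, y = r • x := by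
  obtain ⟨a, h0, h1⟩ := exists_of_projCoord_eq_zero h
  obtain ⟨b, h2, h3⟩ := exists_of_projCoord_eq_zero h'
  have ha : a ≠ 0 := by
    rintro rfl
    refine hx ?_
    ext i
    fin_cases i <;> simp [h0, h1]
  refine ⟨b / a, ?_⟩
  ext i
  fin_cases i <;> simp [h0, h1, h2, h3] <;> field_simp

theorem projCoord_eq_zero_transfer {φ ψ : ℝ} {x y : E} (hx : x ≠ 0) (h : projCoord φ x = 0)
    (h' : projCoord ψ x = 0) (hy : projCoord φ y = 0) : projCoord ψ y = 0 := by
  obtain ⟨r, rfl⟩ := eq_smul_of_projCoord_eq_zero hx h hy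
  rw [projCoord_smul, h', mul_zero]

theorem projCoord_antisymm {φ : ℝ} {x : E} (h : projCoord φ x = 0) (ε : ℝ) :
    projCoord (φ - ε) x = -projCoord (φ + ε) x := by
  rw [projCoord] at *
  rw [projCoord, Real.cos_sub, Real.sin_sub, Real.cos_add, Real.sin_add]
  linear_combination 2 * Real.cos ε * h

theorem projCoord_add_ne_zero {φ : ℝ} {x : E} (hx : x ≠ 0) (h : projCoord φ x = 0) {ε : ℝ}
    (hε : 0 < ε) (hεπ : ε < Real.pi) : projCoord (φ + ε) x ≠ 0 := by
  intro h'
  obtain ⟨a, h0, h1⟩ := exists_of_projCoord_eq_zero h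
  have h2 : a * Real.sin ε = 0 := by
    rw [← h', projCoord, h0, h1, Real.cos_add, Real.sin_add]
    linear_combination -(a * Real.sin ε) * Real.sin_sq_add_cos_sq φ
  rcases mul_eq_zero.1 h2 with rfl | h3
  · refine hx ?_
    ext i
    fin_cases i <;> simp [h0, h1]
  · exact (Real.sin_pos_of_pos_of_lt_pi hε hεπ).ne' h3

theorem continuous_projCoord (x : E) : Continuous fun φ => projCoord φ x := by
  unfold projCoord
  fun_prop

/-- Two lines through the origin cannot carry points `a₁, a₂, a₃` and `b₁, b₂` together with points
`c`, `e` on two other lines such that the given pairs of connecting lines are parallel. -/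
theorem false_of_parallels {a₁ a₂ a₃ b₁ b₂ c e : E} {α β γ φ ψ κ ι : ℝ} (ha₁ : a₁ ≠ 0)
    (ha₁α : projCoord α a₁ = 0) (ha₂α : projCoord α a₂ = 0) (ha₃α : projCoord α a₃ = 0)
    (hb₁α : projCoord α b₁ ≠ 0) (hb₁ : projCoord β b₁ = 0) (hb₂ : projCoord β b₂ = 0)
    (hcγ : projCoord γ c = 0) (heγ : projCoord γ e ≠ 0) (ha₂ : a₂ ≠ 0)
    (h11 : projCoord φ a₁ = projCoord φ b₁) (h22 : projCoord φ a₂ = projCoord φ b₂)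
    (h21 : projCoord ψ a₂ = projCoord ψ b₁) (h32 : projCoord ψ a₃ = projCoord ψ b₂)
    (h1c : projCoord κ a₁ = projCoord κ c) (h2e : projCoord κ a₂ = projCoord κ e)
    (h2c : projCoord ι a₂ = projCoord ι c) (h3e : projCoord ι a₃ = projCoord ι e)
    (hκι : ∀ x : E, projCoord κ x = 0 → projCoord ι x = 0 → x = 0) : False := by
  have hb₁0 : b₁ ≠ 0 := by
    rintro rfl
    exact hb₁α (by simp [projCoord])
  obtain ⟨r, rfl⟩ := eq_smul_of_projCoord_eq_zero ha₁ ha₁α ha₂α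
  obtain ⟨s, rfl⟩ := eq_smul_of_projCoord_eq_zero hb₁0 hb₁ hb₂
  -- If the ratios differed, `φ` would be normal to `a₁` and `b₁` alike, putting both on one line.
  have hrs : s = r := by
    by_contra hne
    have h0 : (s - r) * projCoord φ a₁ = 0 := by
      rw [projCoord_smul, projCoord_smul, ← h11] at h22
      linear_combination -h22
    have h1 := (mul_eq_zero.1 h0).resolve_left (sub_ne_zero.2 hne)
    exact hb₁α (projCoord_eq_zero_transfer ha₁ h1 ha₁α (by rw [← h11, h1]))
  subst hrs
  have ha₃ : a₃ - s • s • a₁ = 0 := by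
    by_contra hne
    have h0 : projCoord ψ (a₃ - s • s • a₁) = 0 := by
      rw [projCoord_sub, projCoord_smul, h21, h32, projCoord_smul, sub_self]
    have h1 : projCoord α (a₃ - s • s • a₁) = 0 := by
      rw [projCoord_sub, projCoord_smul, ha₃α, ha₂α, mul_zero, sub_zero]
    have h2 := projCoord_eq_zero_transfer hne h1 h0 ha₂α
    exact hb₁α (projCoord_eq_zero_transfer ha₂ h2 ha₂α (by rw [← h21, h2]))
  rw [sub_eq_zero] at ha₃
  subst ha₃
  -- The ratio `s` carries `a₁, a₂` to `a₂, a₃`, so `e` and `s • c` agree in two independent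
  -- projections.
  have he := hκι (e - s • c)
    (by rw [projCoord_sub, projCoord_smul, ← h1c, ← h2e, projCoord_smul, sub_self])
    (by rw [projCoord_sub, projCoord_smul, ← h2c, ← h3e, projCoord_smul _ s (s • a₁), sub_self])
  rw [sub_eq_zero] at he
  exact heγ (by rw [he, projCoord_smul, hcγ, mul_zero])

end projCoord

/-! ### Realizations and the contradiction. -/

namespace AllowableSequence

variable {m : ℕ} {A : AllowableSequence m} {p : Fin m → EuclideanSpace ℝ (Fin 2)} {θ : ℤ → ℝ}

/-- The projections depend continuously on the angle, and their order differs on the two sides of `θ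
j`. -/
theorem projCoord_eq_of_height_lt (hθ : StrictMono θ)
    (hord : ∀ i, ∀ φ ∈ Set.Ioo (θ i) (θ (i + 1)), ∀ a b,
      A.perm i a < A.perm i b ↔ projCoord φ (p a) < projCoord φ (p b))
    {j : ℤ} {a b : Fin m} (hab : A.height (j - 1) a < A.height (j - 1) b)
    (hba : A.height j b < A.height j a) : projCoord (θ j) (p a) = projCoord (θ j) (p b) := by
  rw [height_lt_height] at hab hba
  have ha := (continuous_projCoord (p a)).tendsto (θ j)
  have hb := (continuous_projCoord (p b)).tendsto (θ j)
  refine le_antisymm ?_ ?_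
  · refine le_of_tendsto_of_tendsto (ha.mono_left nhdsWithin_le_nhds)
      (hb.mono_left nhdsWithin_le_nhds) (b := nhdsWithin (θ j) (Set.Iio (θ j))) ?_
    filter_upwards [Ioo_mem_nhdsLT (hθ (sub_one_lt j))] with φ hφ
    exact ((hord (j - 1) φ (by rwa [sub_add_cancel]) a b).1 hab).le
  · refine le_of_tendsto_of_tendsto (hb.mono_left nhdsWithin_le_nhds)
      (ha.mono_left nhdsWithin_le_nhds) (b := nhdsWithin (θ j) (Set.Ioi (θ j))) ?_
    filter_upwards [Ioo_mem_nhdsGT (hθ (lt_add_one j))] with φ hφ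
    exact ((hord j φ hφ b a).1 hba).le

/-- The difference of the two projections is a nonzero sinusoid of the angle, so it changes sign at
a zero. -/
theorem height_lt_of_projCoord_eq (hp : Function.Injective p) (hθ : StrictMono θ)
    (hord : ∀ i, ∀ φ ∈ Set.Ioo (θ i) (θ (i + 1)), ∀ a b,
      A.perm i a < A.perm i b ↔ projCoord φ (p a) < projCoord φ (p b))
    {j : ℤ} {a b : Fin m} (hab : a ≠ b) (h : projCoord (θ j) (p a) = projCoord (θ j) (p b)) :
    A.height (j - 1) a < A.height (j - 1) b ↔ A.height j b < A.height j a := by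
  have h1 := hθ (sub_one_lt j)
  have h2 := hθ (lt_add_one j)
  obtain ⟨ε, hε0, hε⟩ := exists_between
    (lt_min (lt_min (sub_pos.2 h1) (sub_pos.2 h2)) Real.pi_pos)
  rw [lt_min_iff, lt_min_iff] at hε
  have h0 : projCoord (θ j) (p a - p b) = 0 := by rw [projCoord_sub, h, sub_self]
  have hne := projCoord_add_ne_zero (sub_ne_zero.2 (hp.ne hab)) h0 hε0 hε.2
  have hanti := projCoord_antisymm h0 ε
  rw [projCoord_sub, projCoord_sub] at hanti
  rw [projCoord_sub] at hne
  rw [height_lt_height, height_lt_height,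
    hord (j - 1) (θ j - ε) ⟨by linarith, by rw [sub_add_cancel]; linarith⟩,
    hord j (θ j + ε) ⟨by linarith, by linarith⟩]
  constructor <;> intro h3
  · linarith
  · linarith

end AllowableSequence

namespace AllowableSequence

variable {m : ℕ} {A : AllowableSequence m}

theorem not_geometricallyRealizable_of_net {N : CrossingNet (Fin m)} (hx : N.x = A.height)
    (hbar : N.bar = Fin.rev) (hN : N.Tight) (ht : 3 ≤ N.t) {k l : ℤ} (hkl : k < l)
    (hl : l < k + N.t) (hk3 : 3 ≤ N.δ k) (hl2 : 2 ≤ N.δ l) : ¬A.GeometricallyRealizable := by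
  rintro ⟨p, hp, θ, hθ, -, hord⟩
  have hrev : ∀ i a, A.height i a.rev = -A.height i a := by
    rw [← hx, ← hbar]
    exact N.x_bar
  have hsep : ∀ (j : ℤ) (a : Fin m), 0 < A.height j a → a ≠ a.rev := by
    intro j a h h'
    have := hrev j a
    rw [← h'] at this
    omega
  -- The conjugate wires are transposed in the same move. The point set itself need not be centrally
  -- symmetric, hence the differences.
  have heq : ∀ {k l r q j : ℤ}, k < l → l < k + N.t → 1 ≤ r → r ≤ N.δ k → 1 ≤ q → q ≤ N.δ l →
      N.IsTime k r l q j → projCoord (θ j) (p (N.W k r)) = projCoord (θ j) (p (N.V l q)) ∧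
        projCoord (θ j) (p (N.W k r) - p (N.W k r).rev) =
          projCoord (θ j) (p (N.V l q) - p (N.V l q).rev) := by
    intro k l r q j hkl hl hr hr' hq hq' h
    have h1 := h.1
    have h2 := h.2.1
    have h3 := h.lt (i := j - 1) (by omega) (by omega)
    have h4 := h.gt hkl hl hr hr' hq hq' le_rfl h2
    rw [hx] at h3 h4
    have h5 := projCoord_eq_of_height_lt hθ hord h3 h4
    have h6 := projCoord_eq_of_height_lt hθ hord (j := j) (a := (N.V l q).rev)
      (b := (N.W k r).rev) (by rw [hrev, hrev]; omega) (by rw [hrev, hrev]; omega)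
    exact ⟨h5, by rw [projCoord_sub, projCoord_sub, h5, h6]⟩
  have hon : ∀ {k r : ℤ}, 1 ≤ r → r ≤ N.δ k →
      projCoord (θ (N.T k)) (p (N.W k r)) = projCoord (θ (N.T k)) (p (N.W k r).rev) := by
    intro k r hr hr'
    have h1 := N.x_W k r hr hr'
    have h2 := N.x_pred_W hr hr'
    rw [hx] at h1 h2
    exact projCoord_eq_of_height_lt hθ hord (by rw [hrev]; omega) (by rw [hrev]; omega)
  have honW : ∀ {k r : ℤ}, 1 ≤ r → r ≤ N.δ k →
      projCoord (θ (N.T k)) (p (N.W k r) - p (N.W k r).rev) = 0 := by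
    intro k r hr hr'
    rw [projCoord_sub, hon hr hr', sub_self]
  have honV : ∀ {k r : ℤ}, 1 ≤ r → r ≤ N.δ k →
      projCoord (θ (N.T k)) (p (N.V k r) - p (N.V k r).rev) = 0 := by
    intro k r hr hr'
    rw [CrossingNet.V, hbar, Fin.rev_rev, projCoord_sub, hon hr hr', sub_self]
  have hoff : ∀ {k l q : ℤ}, k < l → l < k + N.t → 1 ≤ q → q ≤ N.δ l →
      projCoord (θ (N.T k)) (p (N.V l q) - p (N.V l q).rev) ≠ 0 := by
    intro k l q hkl hl hq hq' h
    have h1 := CrossingNet.V_far hkl hl hq hq'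
    have h2 := N.δ_pos k
    rw [hx] at h1
    rw [projCoord_sub, sub_eq_zero] at h
    have h3 := (height_lt_of_projCoord_eq hp hθ hord (hsep (N.T k) _ (by omega)).symm h.symm).1
      (by rw [hrev]; omega)
    rw [hrev] at h3
    omega
  have hWne : ∀ {k r : ℤ}, 1 ≤ r → r ≤ N.δ k → p (N.W k r) - p (N.W k r).rev ≠ 0 := by
    intro k r hr hr'
    have h1 := N.x_W k r hr hr'
    rw [hx] at h1
    exact sub_ne_zero.2 (hp.ne (hsep (N.T k) _ (by omega)))
  have hTk := hN k
  have hTk1 := hN (k + 1)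
  rw [show k + 1 + 1 = k + 2 by ring] at hTk1
  have hd1 := N.δ_pos (k + 1)
  have hd2 := N.δ_pos (k + 2)
  have ht1 : 1 < N.t := by omega
  have h01 : k < k + 1 := by omega
  have h01' : k + 1 < k + N.t := by omega
  have h02 : k < k + 2 := by omega
  have h02' : k + 2 < k + N.t := by omega
  obtain ⟨φ, hφ, h11⟩ := hN.exists_isTime ht1 hkl hl (p := 1) (q := 1) (by omega) (by omega)
    (by omega) (by omega)
  obtain ⟨φ', hφ', h22⟩ := hN.exists_isTime ht1 hkl hl (p := 2) (q := 2) (by omega) (by omega)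
    (by omega) (by omega)
  obtain rfl : φ' = φ := by omega
  obtain ⟨ψ, hψ, h21⟩ := hN.exists_isTime ht1 hkl hl (p := 2) (q := 1) (by omega) (by omega)
    (by omega) (by omega)
  obtain ⟨ψ', hψ', h32⟩ := hN.exists_isTime ht1 hkl hl (p := 3) (q := 2) (by omega) (by omega)
    (by omega) (by omega)
  obtain rfl : ψ' = ψ := by omega
  obtain ⟨κ, hκ, h1c⟩ := hN.exists_isTime ht1 h01 h01' (p := 1) (q := N.δ (k + 1)) (by omega)
    (by omega) hd1 le_rfl
  obtain ⟨κ', hκ', h2e⟩ := hN.exists_isTime ht1 h02 h02' (p := 2) (q := 1) (by omega) (by omega)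
    (by omega) hd2
  -- The times agree because tightness gives `T (k + 2) - δ (k + 2) = T (k + 1) + δ (k + 1)`.
  obtain rfl : κ' = κ := by omega
  obtain ⟨ι, hι, h2c⟩ := hN.exists_isTime ht1 h01 h01' (p := 2) (q := N.δ (k + 1)) (by omega)
    (by omega) hd1 le_rfl
  obtain ⟨ι', hι', h3e⟩ := hN.exists_isTime ht1 h02 h02' (p := 3) (q := 1) (by omega) (by omega)
    (by omega) hd2
  obtain rfl : ι' = ι := by omega
  have e1c := heq h01 h01' (by omega) (by omega) hd1 le_rfl h1c
  have e2c := heq h01 h01' (by omega) (by omega) hd1 le_rfl h2c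
  refine false_of_parallels (hWne (k := k) (r := 1) (by omega) (by omega))
    (honW (by omega) (by omega)) (honW (k := k) (r := 2) (by omega) (by omega))
    (honW (k := k) (r := 3) (by omega) (by omega))
    (hoff hkl hl (q := 1) (by omega) (by omega)) (honV (by omega) (by omega))
    (honV (k := l) (r := 2) (by omega) (by omega))
    (honV (k := k + 1) (r := N.δ (k + 1)) hd1 le_rfl)
    (hoff (k := k + 1) (l := k + 2) (q := 1) (by omega) (by omega) le_rfl hd2)
    (hWne (by omega) (by omega))
    (heq hkl hl (by omega) (by omega) (by omega) (by omega) h11).2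
    (heq hkl hl (by omega) (by omega) (by omega) (by omega) h22).2
    (heq hkl hl (by omega) (by omega) (by omega) (by omega) h21).2
    (heq hkl hl (by omega) (by omega) (by omega) (by omega) h32).2
    e1c.2 (heq h02 h02' (by omega) (by omega) (by omega) hd2 h2e).2
    e2c.2 (heq h02 h02' (by omega) (by omega) (by omega) hd2 h3e).2 fun x hxκ hxι => ?_
  -- If both directions had a common normal, `W k 1` and `W k 2` would project equally at time `κ'`,
  -- where their order does not change.
  by_contra hx0
  have hκ2 := projCoord_eq_zero_transfer hx0 hxι hxκ
    (y := p (N.W k 2) - p (N.V (k + 1) (N.δ (k + 1))))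
    (by rw [projCoord_sub, e2c.1, sub_self])
  rw [projCoord_sub, ← e1c.1, sub_eq_zero] at hκ2
  have hb1 := h1c.1
  have hb2 := h1c.2.1
  have hT := CrossingNet.T_lt_add h01'
  have hlt1 := N.W_lt_W (k := k) (p := 1) (p' := 2) (i := κ' - 1) le_rfl (by omega) (by omega)
    (by omega) (by omega)
  have hlt2 := N.W_lt_W (k := k) (p := 1) (p' := 2) (i := κ') le_rfl (by omega) (by omega)
    (by omega) (by omega)
  rw [hx] at hlt1 hlt2
  have := (height_lt_of_projCoord_eq hp hθ hord (fun h => by rw [h] at hlt1; omega) hκ2.symm).1 hlt1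
  omega

end AllowableSequence

theorem theorem4p6 {t : ℕ} (ht : 3 ≤ t) (d : Fin t → ℕ) (hd : ∀ k, 0 < d k)
    (i j : Fin t) (hij : i ≠ j) (hi : 3 ≤ d i) (hj : 2 ≤ d j)
    {m : ℕ} (A : AllowableSequence m) (hA : A.IsDCncgen d) :
    ¬ A.GeometricallyRealizable := by
  have : NeZero t := ⟨by omega⟩
  obtain ⟨N, hx, hbar, -, hNt, hδ, hN⟩ := hA.exists_net (by omega) hd
  have hδ' : ∀ (r : Fin t) (z : ℤ), N.δ (r + t * z) = d r := fun r z => by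
    rw [hδ, residue_add_mul]
  have hk := hδ' i 0
  rw [mul_zero, add_zero] at hk
  rcases lt_or_gt_of_ne (Fin.val_ne_of_ne hij) with h | h
  · have hl := hδ' j 0
    rw [mul_zero, add_zero] at hl
    exact AllowableSequence.not_geometricallyRealizable_of_net hx hbar hN (by omega)
      (k := (i : ℕ)) (l := (j : ℕ)) (by omega) (by omega) (by omega) (by omega)
  -- Crossing `j` of the next halfperiod, so that it comes after crossing `i`.
  · have hl := hδ' j 1
    rw [mul_one] at hl
    exact AllowableSequence.not_geometricallyRealizable_of_net hx hbar hN (by omega)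
      (k := (i : ℕ)) (l := (j : ℕ) + t) (by omega) (by omega) (by omega) (by omega)
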